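/- **Setting.** $N\ge 1$ nodes are placed independently and uniformly at random in a rectangle $[0,a]\times[0,b]$, $a,b>0$. Two distinct nodes are adjacent in the conflict graph $G$ iff their Euclidean distance is at most $2$ (their unit disks intersect). The average degree is $d=\mathbb E\big[\tfrac1N\sum_i\deg_G(i)\big]$. There are $M\ge1$ channels. The extended conflict graph $H$ has the vertices $v_{i,j}$ ($1\le i\le N$, $1\le j\le M$), with $v_{i,j}\sim v_{i,k}$ for $j\ne k$, and $v_{i,j}\sim v_{p,j}$ whenever $i$ and $p$ are adjacent in $G$. Each vertex has a weight $w_v\ge0$; the weights are arbitrary but do not depend on the random locations. $W(I)=\sum_{v\in I}w_v$, and a maximum weighted independent set (MWIS) maximizes $W$ over independent sets. **Algorithm 2** with parameter $r\ge 1$, stopped after $D$ mini-rounds. All vertices start as candidates. In a mini-round, a candidate is a local leader if its weight is maximal among the candidates within $2r+1$ hops of it in $H$ (ties broken by the vertex numbers). Each local leader $v$ computes, by enumerating independent sets, a MWIS of the set $A_r(v)$ of candidates within $r$ hops of it (itself included); the members of this MWIS become winners and the other members of $A_r(v)$ losers. Then every remaining candidate adjacent to a new winner becomes a loser. The output is the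 set of winners after $D$ mini-rounds. The running time of a vertex is the number of elementary steps it makes in the $D$ mini-rounds. A local leader's enumeration is charged for adjacency tests, additions and comparisons of weights, and visited nodes of the search tree. A candidate is also charged one comparison and one status update per candidate within $2r+1$ hops, and a local leader one status determination per candidate within $r$ hops. **Theorem.** Let $M,r\ge1$ and let $\rho>1$ be such that $M(2r+1)^2\le\rho^r$. There are constants $\alpha\ge1$, $p>0$ and $C>0$, depending only on $M$, $r$ and $\rho$, such that for every average degree $d$, every number $D\ge1$ of mini-rounds, all $N\ge 1$ and all $a,b>0$ for which the random network has average degree $d$, and all such weights: 1. with probability at least $p$, the output $I$ is an independent set of $H$ with $W(\mathrm{MWIS}(H))\le\alpha\,W(I)$; 2. the expected running time of every vertex is at most $C\,D\,\max(1,d)^{\rho^r}$. In particular, for a constant number $D$ of mini-rounds (however large $N$ is), the algorithm is an $\alpha$-approximation, with $\alpha$ constant, with constant probability, and the time of the strategy decision is $O(d^{\rho^r})$. -/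

import Mathlib

namespace ChannelAccess

noncomputable section

/-- Points of the Euclidean plane. -/
abbrev Point := EuclideanSpace ℝ (Fin 2)

/-! ### The random network and its extended conflict graph -/

/-- The unit disk conflict graph of nodes placed at `x`: every node is the centre of a disk of
radius one, and two distinct nodes conflict iff their disks intersect. -/
def conflictGraph {N : ℕ} (x : Fin N → Point) : SimpleGraph (Fin N) where
  Adj i j := i ≠ j ∧ dist (x i) (x j) ≤ 2
  symm := ⟨fun i j h => ⟨h.1.symm, by rw [dist_comm]; exact h.2⟩⟩
  loopless := ⟨fun _ h => h.1 rfl⟩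

/-- The extended conflict graph with `M` channels: the vertex `(i, j)` stands for node `i` using
channel `j`. The vertices of one node form a clique, and conflicting nodes are joined on equal
channels. -/
def extendedGraph {N : ℕ} (M : ℕ) (G : SimpleGraph (Fin N)) :
    SimpleGraph (Fin N × Fin M) where
  Adj u v := (u.1 = v.1 ∧ u.2 ≠ v.2) ∨ (G.Adj u.1 v.1 ∧ u.2 = v.2)
  symm := ⟨fun _ _ h => h.elim (fun h => Or.inl ⟨h.1.symm, h.2.symm⟩)
    (fun h => Or.inr ⟨h.1.symm, h.2.symm⟩)⟩
  loopless := ⟨fun _ h => h.elim (fun h => h.2 rfl) (fun h => G.irrefl h.1)⟩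

/-- The deployment area, a rectangle with sides `a` and `b`. -/
def rectangle (a b : ℝ) : Set Point :=
  {y | 0 ≤ y 0 ∧ y 0 ≤ a ∧ 0 ≤ y 1 ∧ y 1 ≤ b}

/-- The law of `N` independent node locations, each uniformly distributed on the rectangle. -/
def locationLaw (N : ℕ) (a b : ℝ) : MeasureTheory.Measure (Fin N → Point) :=
  MeasureTheory.Measure.pi fun _ =>
    ProbabilityTheory.cond (MeasureTheory.volume : MeasureTheory.Measure Point) (rectangle a b)

open Classical in
/-- The mean, over the `N` nodes, of the degrees in a graph. -/
def meanDegree {N : ℕ} (G : SimpleGraph (Fin N)) : ℝ :=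
  (∑ i, (G.degree i : ℝ)) / N

/-- The average degree of the random network: the expectation of the mean degree. -/
def averageDegree (N : ℕ) (a b : ℝ) : ℝ :=
  ∫ x, meanDegree (conflictGraph x) ∂(locationLaw N a b)

/-! ### Weighted independent sets -/

/-- The summed weight of a set of vertices. -/
def weight {V : Type*} (w : V → ℝ) (I : Finset V) : ℝ := ∑ v ∈ I, w v

/-- `I` is an independent set of `H`. -/
def Independent {V : Type*} (H : SimpleGraph V) (I : Finset V) : Prop :=
  H.IsIndepSet (I : Set V)

/-- `I` is a maximum weighted independent set for the vertex set `A`. -/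
def IsMWIS {V : Type*} (H : SimpleGraph V) (w : V → ℝ) (A I : Finset V) : Prop :=
  I ⊆ A ∧ Independent H I ∧ ∀ J ⊆ A, Independent H J → weight w J ≤ weight w I

/-- `I` is an `α`-approximation to a maximum weighted independent set of the whole graph: it is
an independent set, and the optimum is at most `α` times its weight. -/
def IsApproxMWIS {V : Type*} (H : SimpleGraph V) (w : V → ℝ) (α : ℝ) (I : Finset V) : Prop :=
  Independent H I ∧ ∀ J : Finset V, Independent H J → weight w J ≤ α * weight w I

/-! ### Local computation by enumeration, with a step count -/

/-- The result of a computation with the number of elementary steps it has used. -/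
structure Counted (α : Type*) where
  value : α
  steps : ℕ

open Classical in
/-- Enumeration of all independent sets that extend `S` by vertices of the list, keeping one of
largest weight. Elementary steps are: one per adjacency test, one per weight that is added up,
one per comparison of two weights, and one for every visited node of the search tree. -/
def search {V : Type*} (H : SimpleGraph V) (w : V → ℝ) :
    Finset V → List V → Counted (Finset V)
  | S, [] => ⟨S, 1⟩
  | S, v :: l =>
    let skip := search H w S l
    if ∀ u ∈ S, ¬ H.Adj u v then
      let take := search H w (insert v S) l
      ⟨if weight w skip.value ≤ weight w take.value then take.value else skip.value,
        S.card + skip.steps + take.steps + skip.value.card + take.value.card + 2⟩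
    else
      ⟨skip.value, S.card + skip.steps + 1⟩

/-- The local computation of a maximum weighted independent set for `A` by enumeration. -/
def localMWIS {V : Type*} (H : SimpleGraph V) (w : V → ℝ) (A : Finset V) :
    Counted (Finset V) :=
  search H w ∅ A.toList

/-! ### The distributed algorithm -/

/-- A global snapshot between two mini-rounds. A vertex that is neither a candidate nor a winner
is a loser. -/
structure State (V : Type*) where
  candidates : Finset V
  winners : Finset V

section Algorithm

open Classical

variable {N M : ℕ} (H : SimpleGraph (Fin N × Fin M)) (w : Fin N × Fin M → ℝ) (r : ℕ)

/-- All candidates within `k` hops of `v` in `H`, including `v` if it is a candidate. -/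
def candidatesWithin (s : State (Fin N × Fin M)) (k : ℕ) (v : Fin N × Fin M) :
    Finset (Fin N × Fin M) :=
  s.candidates.filter fun u => H.edist v u ≤ k

/-- `u` is not heavier than `v`, ties being broken by the vertex numbers. -/
def NotHeavier (u v : Fin N × Fin M) : Prop :=
  w u < w v ∨ (w u = w v ∧ finProdFinEquiv u ≤ finProdFinEquiv v)

/-- A local leader is a candidate of maximum weight among the candidates within `2r+1` hops. -/
def IsLocalLeader (s : State (Fin N × Fin M)) (v : Fin N × Fin M) : Prop :=
  v ∈ s.candidates ∧ ∀ u ∈ candidatesWithin H s (2 * r + 1) v, NotHeavier w u v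

/-- The local leaders of a mini-round. -/
def localLeaders (s : State (Fin N × Fin M)) : Finset (Fin N × Fin M) :=
  s.candidates.filter (IsLocalLeader H w r s)

/-- The vertices that the local leaders of a mini-round mark as winners. -/
def newWinners (s : State (Fin N × Fin M)) : Finset (Fin N × Fin M) :=
  (localLeaders H w r s).biUnion fun v =>
    (localMWIS H w (candidatesWithin H s r v)).value

/-- One mini-round. Every local leader decides all candidates within `r` hops, as winners if they
are in its local maximum weighted independent set and as losers otherwise. A remaining candidate
that learns that a neighbour has become a winner becomes a loser. -/
def miniRound (s : State (Fin N × Fin M)) : State (Fin N × Fin M) where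
  candidates := s.candidates.filter fun u =>
    (∀ v ∈ localLeaders H w r s, u ∉ candidatesWithin H s r v) ∧
      ∀ z ∈ newWinners H w r s, ¬ H.Adj z u
  winners := s.winners ∪ newWinners H w r s

/-- The snapshot after `τ` mini-rounds, when at first all vertices are candidates. -/
def stateAfter (τ : ℕ) : State (Fin N × Fin M) :=
  (miniRound H w r)^[τ] ⟨Finset.univ, ∅⟩

/-- The strategy decision: the winners when the algorithm is stopped after `D` mini-rounds. -/
def decision (D : ℕ) : Finset (Fin N × Fin M) := (stateAfter H w r D).winners

/-- The number of elementary steps that vertex `v` performs in a mini-round. A candidate makes one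
comparison for each candidate within `2r+1` hops and at the end one status update for each of
them. A local leader also runs the enumeration and determines the status of every candidate within
`r` hops. Decided vertices do nothing. -/
def miniRoundSteps (s : State (Fin N × Fin M)) (v : Fin N × Fin M) : ℕ :=
  if v ∈ s.candidates then
    2 * (candidatesWithin H s (2 * r + 1) v).card +
      if IsLocalLeader H w r s v then
        (localMWIS H w (candidatesWithin H s r v)).steps + (candidatesWithin H s r v).card
      else 0
  else 0

/-- The number of elementary steps that vertex `v` performs in `D` mini-rounds. -/
def decisionSteps (D : ℕ) (v : Fin N × Fin M) : ℕ :=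
  ∑ τ ∈ Finset.range D, miniRoundSteps H w r (stateAfter H w r τ) v

end Algorithm

/-! ### The enumeration is correct -/

theorem search_spec {V : Type*} (H : SimpleGraph V) (w : V → ℝ) (l : List V) :
    ∀ S : Finset V, Independent H S →
      S ⊆ (search H w S l).value ∧
      (∀ v ∈ (search H w S l).value, v ∈ S ∨ v ∈ l) ∧
      Independent H (search H w S l).value ∧
      ∀ J : Finset V, Independent H J → S ⊆ J → (∀ v ∈ J, v ∈ S ∨ v ∈ l) →
        weight w J ≤ weight w (search H w S l).value := by
  classical
  induction l with
  | nil =>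
    intro S hS
    refine ⟨by simp [search], by simp [search], by simpa [search] using hS, ?_⟩
    intro J _ h1 h2
    have : J = S := Finset.Subset.antisymm (fun v hv => by simpa using h2 v hv) h1
    simp [search, this]
  | cons a l ih =>
    intro S hS
    obtain ⟨s1, s2, s3, s4⟩ := ih S hS
    by_cases hfree : ∀ u ∈ S, ¬ H.Adj u a
    · have hins : Independent H (insert a S) := by
        intro x hx y hy hxy
        simp only [Finset.coe_insert, Set.mem_insert_iff, Finset.mem_coe] at hx hy
        rcases hx with rfl | hx <;> rcases hy with rfl | hy
        · exact absurd rfl hxy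
        · exact fun h => hfree y hy h.symm
        · exact hfree x hx
        · exact hS hx hy hxy
      obtain ⟨t1, t2, t3, t4⟩ := ih (insert a S) hins
      have hv : (search H w S (a :: l)).value =
          if weight w (search H w S l).value ≤ weight w (search H w (insert a S) l).value
          then (search H w (insert a S) l).value else (search H w S l).value := by
        simp [search, if_pos hfree]
      have hbest : ∀ J : Finset V, Independent H J → S ⊆ J →
          (∀ v ∈ J, v ∈ S ∨ v ∈ a :: l) →
          weight w J ≤ weight w (search H w S l).value ∨
          weight w J ≤ weight w (search H w (insert a S) l).value := by
        intro J hJ hSJ hJl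
        by_cases ha : a ∈ J
        · right
          refine t4 J hJ (Finset.insert_subset ha hSJ) fun v hvJ => ?_
          have := hJl v hvJ
          simp only [List.mem_cons, Finset.mem_insert] at this ⊢
          tauto
        · left
          refine s4 J hJ hSJ fun v hvJ => ?_
          rcases hJl v hvJ with h | h
          · exact Or.inl h
          · rcases List.mem_cons.1 h with rfl | h
            · exact absurd hvJ ha
            · exact Or.inr h
      rw [hv]
      split_ifs with hc
      · refine ⟨fun v h => t1 (Finset.mem_insert_of_mem h), fun v h => ?_, t3, ?_⟩
        · have := t2 v h
          simp only [List.mem_cons, Finset.mem_insert] at this ⊢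
          tauto
        · intro J h1 h2 h3
          rcases hbest J h1 h2 h3 with h | h
          · exact h.trans hc
          · exact h
      · refine ⟨s1, fun v h => ?_, s3, ?_⟩
        · have := s2 v h
          simp only [List.mem_cons]
          tauto
        · intro J h1 h2 h3
          rcases hbest J h1 h2 h3 with h | h
          · exact h
          · exact h.trans (not_le.1 hc).le
    · have hv : (search H w S (a :: l)).value = (search H w S l).value := by
        simp [search, if_neg hfree]
      rw [hv]
      refine ⟨s1, fun v h => ?_, s3, ?_⟩
      · have := s2 v h
        simp only [List.mem_cons]
        tauto
      · intro J h1 h2 h3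
        refine s4 J h1 h2 fun v hvJ => ?_
        rcases h3 v hvJ with h | h
        · exact Or.inl h
        · rcases List.mem_cons.1 h with rfl | h
          · exfalso
            apply hfree
            intro u hu hadj
            exact h1 (h2 hu) hvJ hadj.ne hadj
          · exact Or.inr h

/-- The local computation returns a maximum weighted independent set. -/
theorem localMWIS_isMWIS {V : Type*} (H : SimpleGraph V) (w : V → ℝ) (A : Finset V) :
    IsMWIS H w A (localMWIS H w A).value := by
  obtain ⟨_, h2, h3, h4⟩ := search_spec H w A.toList ∅ (by simp [Independent])
  refine ⟨fun v hv => ?_, h3, fun J hJ hI => h4 J hI (by simp) fun v hv => ?_⟩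
  · simpa using h2 v hv
  · simpa using hJ hv

end

end ChannelAccess

/-!
One mini-round already yields the approximation, because winners are never withdrawn. Let
`R = 4 * r + 2`, which bounds the Euclidean distance covered by `2 * r + 1` hops, and let `q` be
the share in the rectangle of a square of side `2 * R`, cut off at the sides of the rectangle. Two
given nodes lie within distance `R` with probability at most `q` (`locationLaw_dist_le_le`). Let
`S` consist of the `m` heaviest nodes, each counted with its heaviest channel, where `m` is about
`1 / (2 * q)`, and let `T` be their total weight. By the union bound, a node of `S` has no other
node of `S` within distance `R` with probability at least `1 / 2`, and then it is a leader
(`isLocalLeader_of_notMem_crowded`). The sets decided by distinct leaders are disjoint, so the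
output weighs at least as much as the leaders (`weight_le_weight_decision`), and Markov's inequality
gives weight at least `T / 4` with probability at least `1 / 3`
(`one_third_le_measure_quarter_le_sum`). On the other hand, every independent set has at most `M`
vertices per unit cell of the rectangle (`card_le_of_independent`). The number of cells is of the
order of `1 / q`, hence of `m`, so every independent set weighs at most a constant times `T`
(`sum_le_mul_sum_of_top`).

For the running time, put `E = M * (2 * r + 1) ^ 2`. Comparing areas, an independent set within `r`
hops of a vertex has at most `E - 1` vertices; the inequality is strict since nodes on the same
channel have distance greater than two (`card_lt_of_two_lt_dist`). The enumeration therefore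
costs at most a constant times the `E`-th power of the number of vertices within reach
(`search_steps_le`): the enumerated independent sets account for the exponent `E - 1`, and the
length of the list for the remaining factor. Given the location of a node, the number of near nodes
is a sum of independent indicators, whose mean is at most a constant times the average degree
(`le_averageDegree`, `squareShare_le_sq_mul`), so its `E`-th moment is of the order of
`max 1 d ^ E` (`lintegral_nearCount_pow_le`), and `E ≤ ρ ^ r`.
-/

namespace ChannelAccess

/-! ### Leaders and winners -/

section Winners

variable {N M : ℕ} {H : SimpleGraph (Fin N × Fin M)} {w : Fin N × Fin M → ℝ} {r : ℕ}

theorem notHeavier_iff_toLex_le {u v : Fin N × Fin M} :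
    NotHeavier w u v ↔
      toLex (w u, finProdFinEquiv u) ≤ toLex (w v, finProdFinEquiv v) := by
  simp [NotHeavier, Prod.Lex.toLex_le_toLex]

theorem NotHeavier.trans {u v z : Fin N × Fin M} (h₁ : NotHeavier w u v)
    (h₂ : NotHeavier w v z) : NotHeavier w u z := by
  rw [notHeavier_iff_toLex_le] at *
  exact h₁.trans h₂

theorem NotHeavier.antisymm {u v : Fin N × Fin M} (h₁ : NotHeavier w u v)
    (h₂ : NotHeavier w v u) : u = v := by
  rw [notHeavier_iff_toLex_le] at *
  have h := toLex.injective (h₁.antisymm h₂)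
  exact finProdFinEquiv.injective (Prod.ext_iff.1 h).2

theorem NotHeavier.le {u v : Fin N × Fin M} (h : NotHeavier w u v) : w u ≤ w v :=
  h.elim le_of_lt fun h => h.1.le

theorem mem_candidatesWithin {s : State (Fin N × Fin M)} {k : ℕ} {u v : Fin N × Fin M} :
    u ∈ candidatesWithin H s k v ↔ u ∈ s.candidates ∧ H.edist v u ≤ k := by
  classical
  simp [candidatesWithin]

theorem mem_localLeaders {s : State (Fin N × Fin M)} {v : Fin N × Fin M} :
    v ∈ localLeaders H w r s ↔ IsLocalLeader H w r s v := by
  classical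
  simp only [localLeaders, Finset.mem_filter]
  exact ⟨fun h => h.2, fun h => ⟨h.1, h⟩⟩

/-- Of two leaders within `2r + 1` hops each would be at most as heavy as the other. -/
theorem IsLocalLeader.eq_of_edist_le {s : State (Fin N × Fin M)} {u v : Fin N × Fin M}
    (hu : IsLocalLeader H w r s u) (hv : IsLocalLeader H w r s v)
    (h : H.edist u v ≤ (2 * r + 1 : ℕ)) : u = v := by
  refine NotHeavier.antisymm (w := w) (hv.2 u ?_) (hu.2 v ?_)
  · exact mem_candidatesWithin.2 ⟨hu.1, by rwa [SimpleGraph.edist_comm]⟩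
  · exact mem_candidatesWithin.2 ⟨hv.1, h⟩

theorem IsLocalLeader.eq_of_mem_of_edist_le_one {s : State (Fin N × Fin M)}
    {u v y z : Fin N × Fin M}
    (hu : IsLocalLeader H w r s u) (hv : IsLocalLeader H w r s v)
    (hy : y ∈ candidatesWithin H s r u) (hz : z ∈ candidatesWithin H s r v)
    (h : H.edist y z ≤ 1) : u = v := by
  refine hu.eq_of_edist_le hv ?_
  have hy := (mem_candidatesWithin.1 hy).2
  have hz := (mem_candidatesWithin.1 hz).2
  rw [SimpleGraph.edist_comm] at hz
  calc H.edist u v ≤ H.edist u y + (H.edist y z + H.edist z v) :=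
        SimpleGraph.edist_triangle.trans (by gcongr; exact SimpleGraph.edist_triangle)
    _ ≤ r + (1 + r) := by gcongr
    _ = (2 * r + 1 : ℕ) := by push_cast; ring

theorem mem_newWinners {s : State (Fin N × Fin M)} {z : Fin N × Fin M} :
    z ∈ newWinners H w r s ↔ ∃ v, IsLocalLeader H w r s v ∧
      z ∈ (localMWIS H w (candidatesWithin H s r v)).value := by
  classical
  simp [newWinners, mem_localLeaders]

theorem localMWIS_subset {A : Finset (Fin N × Fin M)} : (localMWIS H w A).value ⊆ A :=
  (localMWIS_isMWIS H w A).1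

theorem independent_newWinners (s : State (Fin N × Fin M)) :
    Independent H (newWinners H w r s) := by
  intro y hy z hz hne hadj
  obtain ⟨u, hu, hyu⟩ := mem_newWinners.1 (Finset.mem_coe.1 hy)
  obtain ⟨v, hv, hzv⟩ := mem_newWinners.1 (Finset.mem_coe.1 hz)
  obtain rfl := hu.eq_of_mem_of_edist_le_one hv (localMWIS_subset hyu) (localMWIS_subset hzv)
    (SimpleGraph.edist_eq_one_iff_adj.2 hadj).le
  exact (localMWIS_isMWIS H w _).2.1 hyu hzv hne hadj

/-- The winners are independent, and no remaining candidate is adjacent to a winner. -/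
theorem independent_winners_stateAfter (τ : ℕ) :
    Independent H (stateAfter H w r τ).winners ∧
      ∀ c ∈ (stateAfter H w r τ).candidates, ∀ z ∈ (stateAfter H w r τ).winners,
        ¬ H.Adj z c := by
  classical
  induction τ with
  | zero => simp [stateAfter, Independent]
  | succ τ ih =>
    rw [stateAfter, Function.iterate_succ_apply', ← stateAfter]
    set s := stateAfter H w r τ
    obtain ⟨h₁, h₂⟩ := ih
    have hnew : ∀ z ∈ newWinners H w r s, z ∈ s.candidates := by
      intro z hz
      obtain ⟨v, -, hzv⟩ := mem_newWinners.1 hz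
      exact (mem_candidatesWithin.1 (localMWIS_subset hzv)).1
    refine ⟨?_, ?_⟩
    · intro y hy z hz hne
      simp only [miniRound, Finset.coe_union, Set.mem_union, Finset.mem_coe] at hy hz
      rcases hy with hy | hy <;> rcases hz with hz | hz
      · exact h₁ hy hz hne
      · exact h₂ z (hnew z hz) y hy
      · exact fun h => h₂ y (hnew y hy) z hz h.symm
      · exact independent_newWinners s hy hz hne
    · intro c hc z hz
      simp only [miniRound, Finset.mem_filter, Finset.mem_union] at hc hz
      rcases hz with hz | hz
      · exact h₂ c hc.1 z hz
      · exact hc.2.2 z hz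

theorem independent_decision (D : ℕ) : Independent H (decision H w r D) :=
  (independent_winners_stateAfter D).1

theorem newWinners_subset_decision {D : ℕ} (hD : 1 ≤ D) :
    newWinners H w r ⟨Finset.univ, ∅⟩ ⊆ decision H w r D := by
  classical
  induction D, hD using Nat.le_induction with
  | base => simp [decision, stateAfter, miniRound]
  | succ D _ ih =>
    refine ih.trans ?_
    rw [decision, decision, stateAfter, stateAfter, Function.iterate_succ_apply']
    exact Finset.subset_union_left

/-- The sets decided by the leaders are disjoint, and each of them receives winners of at least
the weight of its leader. -/
theorem weight_le_weight_decision (hw : ∀ v, 0 ≤ w v) {D : ℕ} (hD : 1 ≤ D)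
    (L : Finset (Fin N × Fin M)) (hL : ∀ v ∈ L, IsLocalLeader H w r ⟨Finset.univ, ∅⟩ v) :
    weight w L ≤ weight w (decision H w r D) := by
  classical
  set s : State (Fin N × Fin M) := ⟨Finset.univ, ∅⟩
  let I := fun v => (localMWIS H w (candidatesWithin H s r v)).value
  have hdisj : Set.PairwiseDisjoint (L : Set (Fin N × Fin M)) I := by
    intro u hu v hv huv
    refine Finset.disjoint_left.2 fun z hzu hzv => huv ?_
    exact (hL u hu).eq_of_mem_of_edist_le_one (hL v hv) (localMWIS_subset hzu)
      (localMWIS_subset hzv) (by simp)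
  calc weight w L ≤ ∑ v ∈ L, weight w (I v) := by
        refine Finset.sum_le_sum fun v hv => ?_
        have := (localMWIS_isMWIS H w (candidatesWithin H s r v)).2.2 {v} (by
          simp [mem_candidatesWithin, (hL v hv).1]) (by simp [Independent])
        simpa [weight] using this
    _ = weight w (L.biUnion I) := (Finset.sum_biUnion hdisj).symm
    _ ≤ weight w (decision H w r D) := by
        refine Finset.sum_le_sum_of_subset_of_nonneg ?_ fun v _ _ => hw v
        refine Finset.Subset.trans (fun z hz => ?_) (newWinners_subset_decision hD)
        obtain ⟨v, hv, hz⟩ := Finset.mem_biUnion.1 hz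
        exact mem_newWinners.2 ⟨v, hL v hv, hz⟩

end Winners

/-! ### The cost of the enumeration -/

/-- If the independent sets that extend `S` by vertices of `l` have at most `κ` vertices, then
along a branch of the search tree at most `κ - #S` vertices are added to `S`, so that the tree has
polynomial size. -/
theorem search_steps_le {V : Type*} (H : SimpleGraph V) (w : V → ℝ) (κ : ℕ) (l : List V) :
    ∀ (S : Finset V) (k : ℕ), Independent H S → l.Nodup → (∀ v ∈ S, v ∉ l) → S.card + k = κ →
      (∀ J : Finset V, Independent H J → (∀ v ∈ J, v ∈ S ∨ v ∈ l) → J.card ≤ κ) →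
      (search H w S l).steps ≤ (3 * κ + 3) * (l.length + 1) ^ (k + 1) := by
  classical
  induction l with
  | nil =>
    intro S k _ _ _ _ _
    simp only [search, List.length_nil, zero_add, one_pow]
    omega
  | cons a l ih =>
    intro S k hS hnd hSl hk hJ
    rw [List.nodup_cons] at hnd
    have hskip := ih S k hS hnd.2 (fun v hv h => hSl v hv (List.mem_cons_of_mem _ h)) hk
      fun J h₁ h₂ => hJ J h₁ fun v hv => (h₂ v hv).imp_right (List.mem_cons_of_mem _)
    have hSκ : S.card ≤ κ := by omega
    obtain ⟨-, s2, s3, -⟩ := search_spec H w l S hS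
    have hskipc : (search H w S l).value.card ≤ κ :=
      hJ _ s3 fun v hv => (s2 v hv).imp_right (List.mem_cons_of_mem _)
    rw [List.length_cons]
    set t := l.length + 1
    by_cases hfree : ∀ u ∈ S, ¬ H.Adj u a
    · have haS : a ∉ S := fun h => hSl a h List.mem_cons_self
      have hins : Independent H (insert a S) := by
        intro x hx y hy hxy
        simp only [Finset.coe_insert, Set.mem_insert_iff, Finset.mem_coe] at hx hy
        rcases hx with rfl | hx <;> rcases hy with rfl | hy
        · exact absurd rfl hxy
        · exact fun h => hfree y hy h.symm
        · exact hfree x hx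
        · exact hS hx hy hxy
      have hcard : (insert a S).card = S.card + 1 := Finset.card_insert_of_notMem haS
      have hinsκ := hJ _ hins fun v hv => by
        rcases Finset.mem_insert.1 hv with rfl | h
        · exact Or.inr List.mem_cons_self
        · exact Or.inl h
      obtain ⟨k, rfl⟩ : ∃ k', k = k' + 1 := ⟨k - 1, by omega⟩
      have hJ' : ∀ J : Finset V, Independent H J → (∀ v ∈ J, v ∈ insert a S ∨ v ∈ l) →
          J.card ≤ κ := fun J h₁ h₂ => hJ J h₁ fun v hv => by
        have := h₂ v hv
        simp only [List.mem_cons, Finset.mem_insert] at this ⊢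
        tauto
      have htake := ih (insert a S) k hins hnd.2 (fun v hv h => by
        rcases Finset.mem_insert.1 hv with rfl | hv
        · exact hnd.1 h
        · exact hSl v hv (List.mem_cons_of_mem _ h)) (by omega) hJ'
      obtain ⟨-, t2, t3, -⟩ := search_spec H w l (insert a S) hins
      have htakec := hJ' _ t3 t2
      have hpow : t ^ (k + 1 + 1) + t ^ (k + 1) + 1 ≤ (t + 1) ^ (k + 1 + 1) := by
        have h : t ^ (k + 1) + 1 ^ (k + 1) ≤ (t + 1) ^ (k + 1) :=
          pow_add_pow_le (Nat.zero_le _) (Nat.zero_le _) (Nat.succ_ne_zero k)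
        rw [one_pow] at h
        calc t ^ (k + 1 + 1) + t ^ (k + 1) + 1 = t * t ^ (k + 1) + (t ^ (k + 1) + 1) := by ring
          _ ≤ t * (t + 1) ^ (k + 1) + (t + 1) ^ (k + 1) := by gcongr; omega
          _ = (t + 1) ^ (k + 1 + 1) := by ring
      have := Nat.mul_le_mul_left (3 * κ + 3) hpow
      simp only [search, if_pos hfree]
      rw [mul_add, mul_add] at this
      omega
    · have hpow : t ^ (k + 1) + 1 ≤ (t + 1) ^ (k + 1) := by
        have h := pow_add_pow_le (Nat.zero_le t) (Nat.zero_le 1) (Nat.succ_ne_zero k)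
        rwa [one_pow] at h
      have := Nat.mul_le_mul_left (3 * κ + 3) hpow
      simp only [search, if_neg hfree]
      rw [mul_add] at this
      omega

theorem localMWIS_steps_le {V : Type*} (H : SimpleGraph V) (w : V → ℝ) (A : Finset V) (κ : ℕ)
    (hκ : ∀ J ⊆ A, Independent H J → J.card ≤ κ) :
    (localMWIS H w A).steps ≤ (3 * κ + 3) * (A.card + 1) ^ (κ + 1) := by
  have := search_steps_le H w κ A.toList ∅ κ (by simp [Independent]) A.nodup_toList (by simp)
    (by simp) fun J h₁ h₂ => hκ J (fun v hv => by simpa using h₂ v hv) h₁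
  simpa [localMWIS] using this

/-- A bound for the steps of a mini-round in terms of the number `n` of vertices within `2r + 1`
hops. -/
theorem miniRoundSteps_le {N M : ℕ} {H : SimpleGraph (Fin N × Fin M)} {w : Fin N × Fin M → ℝ}
    {r : ℕ} (s : State (Fin N × Fin M)) (v : Fin N × Fin M) (κ n : ℕ)
    (hκ : ∀ J ⊆ candidatesWithin H s r v, Independent H J → J.card ≤ κ)
    (hn : (candidatesWithin H s (2 * r + 1) v).card ≤ n) :
    miniRoundSteps H w r s v ≤ (3 * κ + 6) * (n + 1) ^ (κ + 1) := by
  classical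
  have hsub : candidatesWithin H s r v ⊆ candidatesWithin H s (2 * r + 1) v := by
    intro u hu
    rw [mem_candidatesWithin] at *
    exact ⟨hu.1, hu.2.trans (by exact_mod_cast (by omega : r ≤ 2 * r + 1))⟩
  have hrn := (Finset.card_le_card hsub).trans hn
  have hsteps : (localMWIS H w (candidatesWithin H s r v)).steps ≤
      (3 * κ + 3) * (n + 1) ^ (κ + 1) :=
    (localMWIS_steps_le H w _ κ hκ).trans (by gcongr)
  have hpow : n + 1 ≤ (n + 1) ^ (κ + 1) := Nat.le_self_pow (by omega) _
  have : (3 * κ + 6) * (n + 1) ^ (κ + 1) =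
      (3 * κ + 3) * (n + 1) ^ (κ + 1) + 3 * (n + 1) ^ (κ + 1) := by ring
  rw [miniRoundSteps, this]
  split_ifs <;> omega

open MeasureTheory Finset

/-! ### Packing in the plane -/

/-- Hops in the extended conflict graph move the node by a distance of at most two. -/
theorem dist_le_of_edist_le {N M : ℕ} {x : Fin N → Point} {u v : Fin N × Fin M} {k : ℕ}
    (h : (extendedGraph M (conflictGraph x)).edist u v ≤ k) :
    dist (x u.1) (x v.1) ≤ 2 * k := by
  have hwalk : ∀ {u v : Fin N × Fin M} (p : (extendedGraph M (conflictGraph x)).Walk u v),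
      dist (x u.1) (x v.1) ≤ 2 * p.length := by
    intro u v p
    induction p with
    | nil => simp
    | @cons u z v hadj p ih =>
      have hstep : dist (x u.1) (x z.1) ≤ 2 := by
        rcases hadj with h | h
        · rw [h.1]; simp
        · exact h.1.2
      have := dist_triangle (x u.1) (x z.1) (x v.1)
      rw [SimpleGraph.Walk.length_cons]
      push_cast
      linarith
  obtain ⟨p, hp⟩ := SimpleGraph.exists_walk_of_edist_ne_top
    (ne_top_of_le_ne_top (ENat.natCast_ne_top k) h)
  rw [← hp] at h
  have hk : (p.length : ℝ) ≤ k := by exact_mod_cast h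
  linarith [hwalk p]

/-- Points of a disk of radius `ρ` at mutual distances greater than two number less than
`(ρ + 1)²`: since there are finitely many of them, the disjoint unit disks around them can be
replaced by slightly larger ones, which makes the comparison of areas strict. -/
theorem card_lt_of_two_lt_dist {ι : Type*} (s : Finset ι) (x : ι → Point) (p : Point) {ρ : ℝ}
    (hρ : 0 < ρ) (hs : ∀ i ∈ s, dist (x i) p ≤ ρ)
    (hsep : ∀ i ∈ s, ∀ j ∈ s, i ≠ j → 2 < dist (x i) (x j)) :
    (s.card : ℝ) < (ρ + 1) ^ 2 := by
  obtain ⟨δ, hδ1, hδ⟩ : ∃ δ : ℝ, 1 < δ ∧ ∀ i ∈ s, ∀ j ∈ s, i ≠ j → 2 * δ ≤ dist (x i) (x j) := by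
    classical
    let t := (s ×ˢ s).filter fun e => e.1 ≠ e.2
    rcases t.eq_empty_or_nonempty with ht | ht
    · refine ⟨2, by norm_num, fun i hi j hj hij => ?_⟩
      have : (i, j) ∈ t := by simp [t, hi, hj, hij]
      simp [ht] at this
    · obtain ⟨e, he, hmin⟩ := t.exists_min_image (fun e => dist (x e.1) (x e.2)) ht
      simp only [t, mem_filter, mem_product] at he
      refine ⟨dist (x e.1) (x e.2) / 2, ?_, fun i hi j hj hij => ?_⟩
      · linarith [hsep _ he.1.1 _ he.1.2 he.2]
      · have := hmin (i, j) (by simp [t, hi, hj, hij])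
        linarith
  have hδ0 : 0 < δ := by linarith
  have hdisj : (s : Set ι).PairwiseDisjoint fun i => Metric.ball (x i) δ := by
    intro i hi j hj hij
    exact Metric.ball_disjoint_ball (by linarith [hδ i hi j hj hij])
  have hsub : (⋃ i ∈ s, Metric.ball (x i) δ) ⊆ Metric.ball p (ρ + δ) :=
    Set.iUnion₂_subset fun i hi => Metric.ball_subset_ball' (by linarith [hs i hi])
  have harea := measure_mono (μ := (volume : Measure Point)) hsub
  rw [measure_biUnion_finset hdisj fun i _ => measurableSet_ball] at harea
  simp only [Measure.addHaar_ball_of_pos _ _ hδ0,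
    Measure.addHaar_ball_of_pos _ _ (by linarith : 0 < ρ + δ), sum_const, nsmul_eq_mul,
    ← mul_assoc] at harea
  rw [ENNReal.mul_le_mul_iff_left (Metric.measure_ball_pos _ _ zero_lt_one).ne'
    measure_ball_lt_top.ne, finrank_euclideanSpace_fin] at harea
  have hreal : (s.card : ℝ) * δ ^ 2 ≤ (ρ + δ) ^ 2 := by
    have := ENNReal.toReal_le_of_le_ofReal (by positivity) harea
    rwa [ENNReal.toReal_mul, ENNReal.toReal_natCast, ENNReal.toReal_ofReal (by positivity)] at this
  have hlt : (ρ + δ) ^ 2 < (ρ + 1) ^ 2 * δ ^ 2 := by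
    rw [← mul_pow]
    gcongr
    nlinarith
  exact lt_of_mul_lt_mul_right (hreal.trans_lt hlt) (by positivity)

/-- On each channel, the nodes of an independent set are separated. -/
theorem two_lt_dist_of_independent {N M : ℕ} {x : Fin N → Point} {J : Finset (Fin N × Fin M)}
    (hJ : Independent (extendedGraph M (conflictGraph x)) J) {u v : Fin N × Fin M} (hu : u ∈ J)
    (hv : v ∈ J) (huv : u ≠ v) (hc : u.2 = v.2) : 2 < dist (x u.1) (x v.1) := by
  by_contra! h
  exact hJ hu hv huv (Or.inr ⟨⟨fun h' => huv (Prod.ext h' hc), h⟩, hc⟩)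

theorem card_le_of_independent_of_edist_le {N M r : ℕ} (hr : 1 ≤ r) (hM : 1 ≤ M)
    {x : Fin N → Point} (v : Fin N × Fin M) {J : Finset (Fin N × Fin M)}
    (hJ : Independent (extendedGraph M (conflictGraph x)) J)
    (hv : ∀ u ∈ J, (extendedGraph M (conflictGraph x)).edist v u ≤ r) :
    J.card ≤ M * (2 * r + 1) ^ 2 - 1 := by
  classical
  have hfib : ∀ c ∈ (univ : Finset (Fin M)),
      (J.filter fun u => u.2 = c).card ≤ (2 * r + 1) ^ 2 - 1 := by
    intro c _
    have hlt := card_lt_of_two_lt_dist (J.filter fun u => u.2 = c) (fun u => x u.1) (x v.1)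
      (ρ := 2 * r) (by positivity) (fun u hu => by
        rw [dist_comm]
        exact dist_le_of_edist_le (hv u (mem_filter.1 hu).1)) (fun u hu u' hu' hne => by
        rw [mem_filter] at hu hu'
        exact two_lt_dist_of_independent hJ hu.1 hu'.1 hne (hu.2.trans hu'.2.symm))
    have : (J.filter fun u => u.2 = c).card < (2 * r + 1) ^ 2 := by exact_mod_cast hlt
    omega
  have h := card_le_mul_card_image_of_maps_to (fun u _ => mem_univ u.2) _ hfib
  rw [card_univ, Fintype.card_fin, mul_comm, Nat.mul_sub, mul_one] at h
  omega

/-- A unit square of the grid meets an independent set in at most one vertex per channel. -/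
theorem card_le_of_independent {N M : ℕ} {a b : ℝ} {x : Fin N → Point}
    (hx : ∀ i, x i ∈ rectangle a b) {J : Finset (Fin N × Fin M)}
    (hJ : Independent (extendedGraph M (conflictGraph x)) J) :
    J.card ≤ M * ((⌊a⌋₊ + 1) * (⌊b⌋₊ + 1)) := by
  have hinj : Set.InjOn (fun u : Fin N × Fin M => (u.2, ⌊x u.1 0⌋₊, ⌊x u.1 1⌋₊)) J := by
    intro u hu v hv h
    simp only [Prod.mk.injEq] at h
    by_contra hne
    have hd := two_lt_dist_of_independent hJ hu hv hne h.1
    have hcoord : ∀ k : Fin 2, 0 ≤ x u.1 k → 0 ≤ x v.1 k → ⌊x u.1 k⌋₊ = ⌊x v.1 k⌋₊ →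
        (x u.1 k - x v.1 k) ^ 2 ≤ 1 := by
      intro k h₁ h₂ h
      have h₃ := Nat.floor_le h₁
      have h₄ := Nat.lt_floor_add_one (x u.1 k)
      have h₅ := Nat.floor_le h₂
      have h₆ := Nat.lt_floor_add_one (x v.1 k)
      rw [h] at h₃ h₄
      rw [sq_le_one_iff_abs_le_one, abs_le]
      constructor <;> linarith
    have h0 := hcoord 0 (hx u.1).1 (hx v.1).1 h.2.1
    have h1 := hcoord 1 (hx u.1).2.2.1 (hx v.1).2.2.1 h.2.2
    rw [EuclideanSpace.dist_eq, Fin.sum_univ_two, Real.lt_sqrt (by norm_num)] at hd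
    simp only [Real.dist_eq, sq_abs] at hd
    linarith
  have h := card_le_card_of_injOn (t := univ ×ˢ (range (⌊a⌋₊ + 1) ×ˢ range (⌊b⌋₊ + 1))) _
    (fun u _ => by
      simp only [coe_product, Set.mem_prod, mem_coe, mem_univ, mem_range, true_and,
        Order.lt_add_one_iff]
      exact ⟨Nat.floor_mono (hx u.1).2.1, Nat.floor_mono (hx u.1).2.2.2⟩) hinj
  simpa using h

/-! ### The uniform distribution on a rectangle -/

/-- The share of a square of side `t` in a rectangle with sides `a` and `b`, when the square is
placed in a corner and cut off at the sides of the rectangle. -/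
noncomputable def squareShare (a b t : ℝ) : ℝ := min a t * min b t / (a * b)

theorem squareShare_pos {a b t : ℝ} (ha : 0 < a) (hb : 0 < b) (ht : 0 < t) :
    0 < squareShare a b t := by
  unfold squareShare
  positivity

theorem squareShare_le_sq_mul {a b t : ℝ} (ha : 0 < a) (hb : 0 < b) (ht : 1 ≤ t) :
    squareShare a b t ≤ t ^ 2 * squareShare a b 1 := by
  have h : ∀ c : ℝ, 0 < c → min c t ≤ t * min c 1 := by
    intro c hc
    rcases le_total c 1 with h | h
    · rw [min_eq_left h]
      exact (min_le_left _ _).trans (by nlinarith)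
    · rw [min_eq_right h, mul_one]
      exact min_le_right _ _
  rw [squareShare, squareShare, ← mul_div_assoc]
  refine div_le_div_of_nonneg_right ?_ (by positivity)
  calc min a t * min b t ≤ (t * min a 1) * (t * min b 1) := by
        gcongr
        · exact h a ha
        · exact h b hb
    _ = t ^ 2 * (min a 1 * min b 1) := by ring

/-- The number of unit cells of a rectangle is at most of the order of the inverse share. -/
theorem mul_squareShare_le {a b t : ℝ} (ha : 0 < a) (hb : 0 < b) (ht : 0 < t) :
    ((⌊a⌋₊ + 1 : ℝ) * (⌊b⌋₊ + 1)) * squareShare a b t ≤ (t + 1) ^ 2 := by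
  have h : ∀ c : ℝ, 0 < c → (⌊c⌋₊ + 1 : ℝ) * min c t / c ≤ t + 1 := by
    intro c hc
    rw [div_le_iff₀ hc]
    have h₁ := Nat.floor_le hc.le
    have h₂ := min_le_left c t
    have h₃ := min_le_right c t
    have h₄ : 0 < min c t := lt_min hc ht
    nlinarith
  calc ((⌊a⌋₊ + 1 : ℝ) * (⌊b⌋₊ + 1)) * squareShare a b t
      = ((⌊a⌋₊ + 1 : ℝ) * min a t / a) * ((⌊b⌋₊ + 1 : ℝ) * min b t / b) := by
        unfold squareShare; field_simp
    _ ≤ (t + 1) * (t + 1) := by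
        gcongr
        · exact h a ha
        · exact h b hb
    _ = (t + 1) ^ 2 := by ring

theorem measurableSet_box (l₀ u₀ l₁ u₁ : ℝ) :
    MeasurableSet {y : Point | l₀ ≤ y 0 ∧ y 0 ≤ u₀ ∧ l₁ ≤ y 1 ∧ y 1 ≤ u₁} := by
  have h : ∀ k : Fin 2, Measurable fun y : Point => y k := fun k => by fun_prop
  refine (measurableSet_le measurable_const (h 0)).inter ?_
  refine (measurableSet_le (h 0) measurable_const).inter ?_
  exact (measurableSet_le measurable_const (h 1)).inter (measurableSet_le (h 1) measurable_const)

theorem volume_box (l₀ u₀ l₁ u₁ : ℝ) :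
    volume {y : Point | l₀ ≤ y 0 ∧ y 0 ≤ u₀ ∧ l₁ ≤ y 1 ∧ y 1 ≤ u₁} =
      ENNReal.ofReal (u₀ - l₀) * ENNReal.ofReal (u₁ - l₁) := by
  have hpre : {y : Point | l₀ ≤ y 0 ∧ y 0 ≤ u₀ ∧ l₁ ≤ y 1 ∧ y 1 ≤ u₁} =
      WithLp.ofLp ⁻¹' Set.Icc ![l₀, l₁] ![u₀, u₁] := by
    ext y
    simp only [Set.mem_ofPred_eq, Set.mem_preimage, Set.mem_Icc, Pi.le_def, Fin.forall_fin_two,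
      Matrix.cons_val_zero, Matrix.cons_val_one]
    tauto
  rw [hpre, (PiLp.volume_preserving_ofLp (Fin 2)).measure_preimage
    measurableSet_Icc.nullMeasurableSet, Real.volume_Icc_pi, Fin.prod_univ_two]
  simp

theorem measurableSet_rectangle (a b : ℝ) : MeasurableSet (rectangle a b) :=
  measurableSet_box 0 a 0 b

theorem volume_rectangle (a b : ℝ) :
    volume (rectangle a b) = ENNReal.ofReal a * ENNReal.ofReal b :=
  (volume_box 0 a 0 b).trans (by simp)

/-- The uniform distribution on a rectangle. -/
noncomputable abbrev uniformLaw (a b : ℝ) : Measure Point :=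
  ProbabilityTheory.cond volume (rectangle a b)

theorem isProbabilityMeasure_uniformLaw {a b : ℝ} (ha : 0 < a) (hb : 0 < b) :
    IsProbabilityMeasure (uniformLaw a b) := by
  refine ProbabilityTheory.cond_isProbabilityMeasure_of_finite ?_ ?_ <;> rw [volume_rectangle]
  · simp [ha, hb]
  · exact ENNReal.mul_ne_top ENNReal.ofReal_ne_top ENNReal.ofReal_ne_top

theorem uniformLaw_apply {a b : ℝ} (ha : 0 < a) (t : Set Point) :
    uniformLaw a b t = volume (rectangle a b ∩ t) / ENNReal.ofReal (a * b) := by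
  rw [ProbabilityTheory.cond_apply (measurableSet_rectangle a b), volume_rectangle,
    ← ENNReal.ofReal_mul ha.le, mul_comm, div_eq_mul_inv]

theorem ae_mem_rectangle (a b : ℝ) : ∀ᵐ y ∂uniformLaw a b, y ∈ rectangle a b :=
  ProbabilityTheory.ae_cond_mem (measurableSet_rectangle a b)

theorem abs_coord_sub_le_dist (y z : Point) (k : Fin 2) : |y k - z k| ≤ dist y z := by
  rw [← Real.norm_eq_abs]
  simpa [dist_eq_norm] using PiLp.norm_apply_le (y - z) k

theorem uniformLaw_closedBall_le {a b R : ℝ} (ha : 0 < a) (hb : 0 < b) (hR : 0 < R)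
    (y : Point) :
    uniformLaw a b (Metric.closedBall y R) ≤ ENNReal.ofReal (squareShare a b (2 * R)) := by
  rw [uniformLaw_apply ha, squareShare, ENNReal.ofReal_div_of_pos (by positivity)]
  gcongr
  have hsub : rectangle a b ∩ Metric.closedBall y R ⊆
      {z : Point | max 0 (y 0 - R) ≤ z 0 ∧ z 0 ≤ min a (y 0 + R) ∧
        max 0 (y 1 - R) ≤ z 1 ∧ z 1 ≤ min b (y 1 + R)} := by
    rintro z ⟨hz, hzy⟩
    have h0 := abs_le.1 ((abs_coord_sub_le_dist z y 0).trans hzy)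
    have h1 := abs_le.1 ((abs_coord_sub_le_dist z y 1).trans hzy)
    refine ⟨max_le hz.1 ?_, le_min hz.2.1 ?_, max_le hz.2.2.1 ?_, le_min hz.2.2.2 ?_⟩ <;> linarith
  have hlen : ∀ c s : ℝ, min c (s + R) - max 0 (s - R) ≤ min c (2 * R) := by
    intro c s
    refine le_min ?_ ?_
    · linarith [min_le_left c (s + R), le_max_left 0 (s - R)]
    · linarith [min_le_right c (s + R), le_max_right 0 (s - R)]
  refine (measure_mono hsub).trans ?_
  rw [volume_box, ENNReal.ofReal_mul (by positivity)]
  gcongr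
  · exact hlen a _
  · exact hlen b _

theorem le_uniformLaw_closedBall {a b : ℝ} (ha : 0 < a) (hb : 0 < b) {y : Point}
    (hy : y ∈ rectangle a b) :
    ENNReal.ofReal (squareShare a b 1) ≤ uniformLaw a b (Metric.closedBall y 2) := by
  rw [uniformLaw_apply ha, squareShare, ENNReal.ofReal_div_of_pos (by positivity)]
  gcongr
  have hsub : {z : Point | max 0 (y 0 - 1) ≤ z 0 ∧ z 0 ≤ min a (y 0 + 1) ∧
      max 0 (y 1 - 1) ≤ z 1 ∧ z 1 ≤ min b (y 1 + 1)} ⊆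
      rectangle a b ∩ Metric.closedBall y 2 := by
    rintro z ⟨h₁, h₂, h₃, h₄⟩
    rw [max_le_iff] at h₁ h₃
    rw [le_min_iff] at h₂ h₄
    refine ⟨⟨h₁.1, h₂.1, h₃.1, h₄.1⟩, ?_⟩
    rw [Metric.mem_closedBall, EuclideanSpace.dist_eq, Fin.sum_univ_two]
    refine Real.sqrt_le_iff.2 ⟨by norm_num, ?_⟩
    simp only [Real.dist_eq, sq_abs]
    nlinarith
  have hlen : ∀ c s : ℝ, 0 ≤ s → s ≤ c → min c 1 ≤ min c (s + 1) - max 0 (s - 1) := by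
    intro c s h₁ h₂
    rcases min_cases c (s + 1) with h | h <;> rcases max_cases 0 (s - 1) with h' | h' <;>
      rcases min_cases c 1 with h'' | h'' <;> linarith
  refine le_trans ?_ (measure_mono hsub)
  rw [volume_box, ENNReal.ofReal_mul (by positivity)]
  gcongr
  · exact hlen a _ hy.1 hy.2.1
  · exact hlen b _ hy.2.2.1 hy.2.2.2

/-! ### Independent locations -/

/-- Given the location of one node, the locations of the other nodes are independent. -/
theorem lintegral_pi_prod_succAbove {X : Type*} [MeasurableSpace X] (μ : Measure X)
    [IsProbabilityMeasure μ] {n : ℕ} (i : Fin (n + 1)) (f : Fin n → X → X → ENNReal)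
    (hf : ∀ j, Measurable (Function.uncurry (f j))) :
    ∫⁻ x, ∏ j, f j (x i) (x (i.succAbove j)) ∂(Measure.pi fun _ => μ) =
      ∫⁻ y, ∏ j, ∫⁻ z, f j y z ∂μ ∂μ := by
  have hmp := measurePreserving_piFinSuccAbove (fun _ : Fin (n + 1) => μ) i
  have hmeas : Measurable fun e : X × (Fin n → X) => ∏ j, f j e.1 (e.2 j) := by
    refine Finset.measurable_prod _ fun j _ => ?_
    exact (hf j).comp (measurable_fst.prodMk ((measurable_pi_apply j).comp measurable_snd))
  calc ∫⁻ x, ∏ j, f j (x i) (x (i.succAbove j)) ∂(Measure.pi fun _ => μ)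
      = ∫⁻ e, ∏ j, f j e.1 (e.2 j) ∂(μ.prod (Measure.pi fun _ => μ)) :=
        hmp.lintegral_comp hmeas
    _ = ∫⁻ y, ∫⁻ z, ∏ j, f j y (z j) ∂(Measure.pi fun _ => μ) ∂μ :=
        lintegral_prod _ hmeas.aemeasurable
    _ = ∫⁻ y, ∏ j, ∫⁻ z, f j y z ∂μ ∂μ := by
        refine lintegral_congr fun y => ?_
        have hfy : ∀ j, Measurable (f j y) := fun j => (hf j).comp measurable_prodMk_left
        rw [ProbabilityTheory.lintegral_prod_eq_prod_lintegral_of_indepFun univ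
          (fun j (z : Fin n → X) => f j y (z j))
          (ProbabilityTheory.iIndepFun_pi fun j => (hfy j).aemeasurable)
          fun j => (hfy j).comp (measurable_pi_apply j)]
        refine prod_congr rfl fun j _ => ?_
        exact (measurePreserving_eval (fun _ : Fin n => μ) j).lintegral_comp (hfy j)

theorem measurableSet_dist_le {N : ℕ} (i j : Fin N) (R : ℝ) :
    MeasurableSet {x : Fin N → Point | dist (x i) (x j) ≤ R} :=
  measurableSet_le ((measurable_pi_apply i).dist (measurable_pi_apply j)) measurable_const

theorem measure_pi_dist_le {N : ℕ} (μ : Measure Point) [IsProbabilityMeasure μ] {i j : Fin N}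
    (hij : i ≠ j) (R : ℝ) :
    (Measure.pi fun _ : Fin N => μ) {x | dist (x i) (x j) ≤ R} =
      ∫⁻ y, μ (Metric.closedBall y R) ∂μ := by
  classical
  obtain _ | n := N
  · exact i.elim0
  obtain ⟨j, rfl⟩ := Fin.exists_succAbove_eq hij.symm
  let g : Point → Point → ENNReal := fun y z => (Metric.closedBall y R).indicator 1 z
  have hg : Measurable (Function.uncurry g) := by
    have : Function.uncurry g = {e : Point × Point | dist e.2 e.1 ≤ R}.indicator 1 := by
      ext e
      simp [Function.uncurry, g, Set.indicator_apply]
    rw [this]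
    exact measurable_one.indicator
      (measurableSet_le (measurable_snd.dist measurable_fst) measurable_const)
  have h := lintegral_pi_prod_succAbove μ i (fun k => if k = j then g else fun _ _ => 1)
    fun k => by
      split_ifs
      · exact hg
      · exact measurable_const
  have hL : ∀ x : Fin (n + 1) → Point, (∏ k, (if k = j then g else fun _ _ => 1) (x i)
      (x (i.succAbove k))) = {x : Fin (n + 1) → Point | dist (x i) (x (i.succAbove j)) ≤ R}.indicator
        1 x := by
    intro x
    rw [prod_eq_single j (fun k _ hk => by simp [hk]) (by simp)]
    simp [g, Set.indicator_apply, dist_comm]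
  have hR : ∀ y : Point, (∏ k, ∫⁻ z, (if k = j then g else fun _ _ => 1) y z ∂μ) =
      μ (Metric.closedBall y R) := by
    intro y
    rw [prod_eq_single j (fun k _ hk => by simp [hk]) (by simp)]
    simp only [if_true, g]
    exact lintegral_indicator_one Metric.isClosed_closedBall.measurableSet
  simp only [hL, hR] at h
  rw [← h, lintegral_indicator_one (measurableSet_dist_le _ _ _)]

variable {a b : ℝ} {N : ℕ}

theorem isProbabilityMeasure_locationLaw (ha : 0 < a) (hb : 0 < b) :
    IsProbabilityMeasure (locationLaw N a b) := by
  have := isProbabilityMeasure_uniformLaw ha hb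
  unfold locationLaw
  infer_instance

theorem ae_forall_mem_rectangle (ha : 0 < a) (hb : 0 < b) :
    ∀ᵐ x ∂locationLaw N a b, ∀ i, x i ∈ rectangle a b := by
  have := isProbabilityMeasure_uniformLaw ha hb
  rw [ae_all_iff]
  intro i
  exact (Measure.quasiMeasurePreserving_eval (fun _ : Fin N => uniformLaw a b) i).ae
    (ae_mem_rectangle a b)

theorem locationLaw_dist_le_le (ha : 0 < a) (hb : 0 < b) {R : ℝ} (hR : 0 < R) {i j : Fin N}
    (hij : i ≠ j) :
    locationLaw N a b {x | dist (x i) (x j) ≤ R} ≤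
      ENNReal.ofReal (squareShare a b (2 * R)) := by
  have := isProbabilityMeasure_uniformLaw ha hb
  rw [locationLaw, measure_pi_dist_le (uniformLaw a b) hij]
  calc ∫⁻ y, uniformLaw a b (Metric.closedBall y R) ∂uniformLaw a b
      ≤ ∫⁻ _, ENNReal.ofReal (squareShare a b (2 * R)) ∂uniformLaw a b :=
        lintegral_mono fun y => uniformLaw_closedBall_le ha hb hR y
    _ = ENNReal.ofReal (squareShare a b (2 * R)) := by simp

theorem le_locationLaw_dist_le (ha : 0 < a) (hb : 0 < b) {i j : Fin N} (hij : i ≠ j) :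
    ENNReal.ofReal (squareShare a b 1) ≤ locationLaw N a b {x | dist (x i) (x j) ≤ 2} := by
  have := isProbabilityMeasure_uniformLaw ha hb
  rw [locationLaw, measure_pi_dist_le (uniformLaw a b) hij]
  calc ENNReal.ofReal (squareShare a b 1)
      = ∫⁻ _, ENNReal.ofReal (squareShare a b 1) ∂uniformLaw a b := by simp
    _ ≤ ∫⁻ y, uniformLaw a b (Metric.closedBall y 2) ∂uniformLaw a b := by
        refine lintegral_mono_ae ?_
        filter_upwards [ae_mem_rectangle a b] with y hy
        exact le_uniformLaw_closedBall ha hb hy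

theorem le_averageDegree (ha : 0 < a) (hb : 0 < b) (hN : 1 ≤ N) :
    ((N : ℝ) - 1) * squareShare a b 1 ≤ averageDegree N a b := by
  classical
  have := isProbabilityMeasure_locationLaw (N := N) ha hb
  let A : Fin N → Fin N → Set (Fin N → Point) := fun i j => {x | dist (x i) (x j) ≤ 2}
  have hdeg : ∀ x : Fin N → Point, meanDegree (conflictGraph x) =
      (∑ i, ∑ j ∈ univ.erase i, (A i j).indicator (fun _ => (1 : ℝ)) x) / N := by
    intro x
    unfold meanDegree
    congr 1
    refine sum_congr rfl fun i _ => ?_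
    simp only [Set.indicator_apply, sum_boole]
    rw [← SimpleGraph.card_neighborFinset_eq_degree]
    congr 2
    ext j
    rw [SimpleGraph.mem_neighborFinset]
    simp [conflictGraph, A, eq_comm]
  have hint : averageDegree N a b =
      (∑ i, ∑ j ∈ univ.erase i, (locationLaw N a b).real (A i j)) / N := by
    have hI : ∀ i j, Integrable ((A i j).indicator fun _ => (1 : ℝ)) (locationLaw N a b) :=
      fun i j => (integrable_const 1).indicator (measurableSet_dist_le i j 2)
    simp only [averageDegree, hdeg, integral_div]
    rw [integral_finsetSum _ fun i _ => integrable_finsetSum _ fun j _ => hI i j]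
    congr 1
    refine sum_congr rfl fun i _ => ?_
    rw [integral_finsetSum _ fun j _ => hI i j]
    refine sum_congr rfl fun j _ => ?_
    exact integral_indicator_one (measurableSet_dist_le i j 2)
  have hN0 : (0 : ℝ) < N := by exact_mod_cast hN
  rw [hint, le_div_iff₀ hN0]
  calc ((N : ℝ) - 1) * squareShare a b 1 * N
      = ∑ i : Fin N, ∑ j ∈ univ.erase i, squareShare a b 1 := by
        simp only [sum_const, card_erase_of_mem (mem_univ _), card_univ, Fintype.card_fin,
          nsmul_eq_mul, Nat.cast_sub hN, Nat.cast_one]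
        ring
    _ ≤ _ := by
        refine sum_le_sum fun i _ => sum_le_sum fun j hj => ?_
        exact (ENNReal.ofReal_le_iff_le_toReal (measure_ne_top _ _)).1
          (le_locationLaw_dist_le ha hb (ne_of_mem_erase hj).symm)

/-! ### Moments of the number of near nodes -/

open Classical in
/-- The number of nodes other than `i` within distance `R` of node `i`. -/
noncomputable def nearCount (x : Fin N → Point) (R : ℝ) (i : Fin N) : ℕ :=
  ((univ.erase i).filter fun j => dist (x i) (x j) ≤ R).card

/-- The exponential moment of a sum of indicators that are independent given the location of
node `i`. -/
theorem lintegral_exp_nearCount_le (ha : 0 < a) (hb : 0 < b) (hN : 1 ≤ N) {R s : ℝ} (hR : 0 < R)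
    (hs₀ : 0 ≤ s) (hs₁ : s ≤ 1) (i : Fin N) :
    ∫⁻ x, ENNReal.ofReal (Real.exp (s * nearCount x R i)) ∂locationLaw N a b ≤
      ENNReal.ofReal (Real.exp (2 * s * (((N : ℝ) - 1) * squareShare a b (2 * R)))) := by
  classical
  have hμ := isProbabilityMeasure_uniformLaw ha hb
  set q := squareShare a b (2 * R)
  have hq : 0 < q := squareShare_pos ha hb (by linarith)
  obtain ⟨n, rfl⟩ : ∃ n, N = n + 1 := ⟨N - 1, by omega⟩
  let g : Point → Point → ENNReal := fun y z =>
    ENNReal.ofReal (Real.exp (if dist y z ≤ R then s else 0))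
  have hg : Measurable (Function.uncurry g) := by
    refine ENNReal.measurable_ofReal.comp (Real.measurable_exp.comp ?_)
    exact Measurable.ite (measurableSet_le (measurable_fst.dist measurable_snd) measurable_const)
      measurable_const measurable_const
  have hprod : ∀ x : Fin (n + 1) → Point,
      ENNReal.ofReal (Real.exp (s * nearCount x R i)) = ∏ j, g (x i) (x (i.succAbove j)) := by
    intro x
    rw [← ENNReal.ofReal_prod_of_nonneg fun j _ => (Real.exp_pos _).le, ← Real.exp_sum]
    congr 2
    have : nearCount x R i =
        (univ.filter fun j : Fin n => dist (x i) (x (i.succAbove j)) ≤ R).card := by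
      rw [nearCount, ← card_map (Fin.succAboveEmb i)]
      congr 1
      ext j
      simp only [mem_filter, mem_erase, mem_univ, and_true, mem_map, Fin.coe_succAboveEmb,
        true_and]
      constructor
      · rintro ⟨hj, h⟩
        obtain ⟨k, rfl⟩ := Fin.exists_succAbove_eq hj
        exact ⟨k, h, rfl⟩
      · rintro ⟨k, h, rfl⟩
        exact ⟨Fin.succAbove_ne i k, h⟩
    rw [this, ← sum_filter, sum_const, nsmul_eq_mul, mul_comm]
  have hone : ∀ y, ∫⁻ z, g y z ∂uniformLaw a b ≤ ENNReal.ofReal (Real.exp (2 * s * q)) := by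
    intro y
    have hexp : Real.exp s - 1 ≤ 2 * s := by
      have := (abs_le.1 (Real.abs_exp_sub_one_sub_id_le (abs_le.2 ⟨by linarith, hs₁⟩))).2
      nlinarith
    have hexp₀ : 0 ≤ Real.exp s - 1 := by linarith [Real.add_one_le_exp s]
    have hgy : ∀ z, g y z = 1 + (Metric.closedBall y R).indicator
        (fun _ => ENNReal.ofReal (Real.exp s - 1)) z := by
      intro z
      simp only [g, Set.indicator_apply, Metric.mem_closedBall, dist_comm z y]
      split_ifs
      · rw [← ENNReal.ofReal_one, ← ENNReal.ofReal_add zero_le_one hexp₀]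
        congr 1
        ring
      · simp
    simp only [hgy]
    rw [lintegral_add_left measurable_const,
      lintegral_indicator_const Metric.isClosed_closedBall.measurableSet, lintegral_const,
      measure_univ, mul_one]
    calc 1 + ENNReal.ofReal (Real.exp s - 1) * uniformLaw a b (Metric.closedBall y R)
        ≤ 1 + ENNReal.ofReal (2 * s) * ENNReal.ofReal q := by
          gcongr
          exact uniformLaw_closedBall_le ha hb hR y
      _ = ENNReal.ofReal (1 + 2 * s * q) := by
          rw [← ENNReal.ofReal_mul (by positivity), ENNReal.ofReal_add zero_le_one (by positivity),
            ENNReal.ofReal_one]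
      _ ≤ ENNReal.ofReal (Real.exp (2 * s * q)) := by
          gcongr
          linarith [Real.add_one_le_exp (2 * s * q)]
  simp only [hprod]
  rw [locationLaw, lintegral_pi_prod_succAbove (uniformLaw a b) i (fun _ => g) fun _ => hg]
  calc ∫⁻ y, ∏ _j : Fin n, ∫⁻ z, g y z ∂uniformLaw a b ∂uniformLaw a b
      ≤ ∫⁻ _, ENNReal.ofReal (Real.exp (2 * s * q)) ^ n ∂uniformLaw a b := by
        refine lintegral_mono fun y => ?_
        rw [prod_const, card_univ, Fintype.card_fin]
        gcongr
        exact hone y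
    _ = _ := by
        rw [lintegral_const, measure_univ, mul_one, ← ENNReal.ofReal_pow (Real.exp_pos _).le,
          ← Real.exp_nat_mul]
        congr 2
        push_cast
        ring

/-- The power moments follow from the exponential moment with the exponent scaled by the mean. -/
theorem lintegral_nearCount_pow_le (ha : 0 < a) (hb : 0 < b) (hN : 1 ≤ N) {R m : ℝ} (hR : 0 < R)
    (hm : 1 ≤ m) (hmean : ((N : ℝ) - 1) * squareShare a b (2 * R) ≤ m) (i : Fin N) (E : ℕ) :
    ∫⁻ x, ENNReal.ofReal ((nearCount x R i + 1 : ℝ) ^ E) ∂locationLaw N a b ≤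
      ENNReal.ofReal (E.factorial * Real.exp 3 * m ^ E) := by
  have hm0 : 0 < m := by linarith
  have hpt : ∀ t : ℝ, 0 ≤ t →
      (t + 1) ^ E ≤ E.factorial * Real.exp 1 * m ^ E * Real.exp (m⁻¹ * t) := by
    intro t ht
    have h := Real.pow_div_factorial_le_exp (m⁻¹ * (t + 1)) (by positivity) E
    rw [div_le_iff₀ (by positivity), mul_pow, inv_pow, inv_mul_le_iff₀ (by positivity), mul_add,
      mul_one, Real.exp_add] at h
    have hexp : Real.exp m⁻¹ ≤ Real.exp 1 := Real.exp_le_exp.2 (inv_le_one_of_one_le₀ hm)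
    calc (t + 1) ^ E ≤ m ^ E * (Real.exp (m⁻¹ * t) * Real.exp m⁻¹ * E.factorial) := h
      _ ≤ m ^ E * (Real.exp (m⁻¹ * t) * Real.exp 1 * E.factorial) := by gcongr
      _ = _ := by ring
  calc ∫⁻ x, ENNReal.ofReal ((nearCount x R i + 1 : ℝ) ^ E) ∂locationLaw N a b
      ≤ ∫⁻ x, ENNReal.ofReal (E.factorial * Real.exp 1 * m ^ E) *
          ENNReal.ofReal (Real.exp (m⁻¹ * nearCount x R i)) ∂locationLaw N a b := by
        refine lintegral_mono fun x => ?_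
        rw [← ENNReal.ofReal_mul (by positivity)]
        exact ENNReal.ofReal_le_ofReal (hpt _ (Nat.cast_nonneg _))
    _ = ENNReal.ofReal (E.factorial * Real.exp 1 * m ^ E) *
          ∫⁻ x, ENNReal.ofReal (Real.exp (m⁻¹ * nearCount x R i)) ∂locationLaw N a b :=
        lintegral_const_mul' _ _ ENNReal.ofReal_ne_top
    _ ≤ ENNReal.ofReal (E.factorial * Real.exp 1 * m ^ E) * ENNReal.ofReal (Real.exp 2) := by
        gcongr
        refine (lintegral_exp_nearCount_le ha hb hN hR (by positivity)
          (inv_le_one_of_one_le₀ hm) i).trans ?_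
        gcongr
        rw [mul_assoc, inv_mul_eq_div]
        have : ((N : ℝ) - 1) * squareShare a b (2 * R) / m ≤ 1 := (div_le_one hm0).2 hmean
        linarith
    _ = ENNReal.ofReal (E.factorial * Real.exp 3 * m ^ E) := by
        rw [← ENNReal.ofReal_mul (by positivity), show (3 : ℝ) = 1 + 2 by norm_num, Real.exp_add]
        congr 1
        ring

/-! ### The expected running time -/

theorem card_candidatesWithin_le {M k : ℕ} {R : ℝ} (hR : 2 * (k : ℝ) ≤ R) (x : Fin N → Point)
    (s : State (Fin N × Fin M)) (v : Fin N × Fin M) :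
    (candidatesWithin (extendedGraph M (conflictGraph x)) s k v).card ≤
      (nearCount x R v.1 + 1) * M := by
  classical
  have hsub : candidatesWithin (extendedGraph M (conflictGraph x)) s k v ⊆
      insert v.1 ((univ.erase v.1).filter fun j => dist (x v.1) (x j) ≤ R) ×ˢ univ := by
    intro u hu
    have hd := (dist_le_of_edist_le (mem_candidatesWithin.1 hu).2).trans hR
    simp only [mem_product, mem_insert, mem_filter, mem_erase, mem_univ, and_true]
    by_cases h : u.1 = v.1
    · exact Or.inl h
    · exact Or.inr ⟨h, hd⟩
  refine (card_le_card hsub).trans ?_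
  rw [card_product, card_univ, Fintype.card_fin, nearCount]
  gcongr
  exact card_insert_le _ _

/-- The count of near nodes uses the radius `4 * r + 2`, the distance covered by `2 * r + 1`
hops, and the exponent exceeds by one the largest size of an independent set within `r` hops. -/
theorem decisionSteps_le {M r : ℕ} (hM : 1 ≤ M) (hr : 1 ≤ r) (x : Fin N → Point)
    (w : Fin N × Fin M → ℝ) (D : ℕ) (v : Fin N × Fin M) {E : ℕ} (hE : E = M * (2 * r + 1) ^ 2) :
    decisionSteps (extendedGraph M (conflictGraph x)) w r D v ≤
      D * ((3 * E + 3) * (2 * M) ^ E * (nearCount x (4 * r + 2) v.1 + 1) ^ E) := by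
  have hE1 : 1 ≤ E := by rw [hE]; exact Nat.mul_pos hM (by positivity)
  have hstep : ∀ s, miniRoundSteps (extendedGraph M (conflictGraph x)) w r s v ≤
      (3 * E + 3) * (2 * M) ^ E * (nearCount x (4 * r + 2) v.1 + 1) ^ E := by
    intro s
    have h := miniRoundSteps_le (w := w) s v (E - 1) ((nearCount x (4 * r + 2) v.1 + 1) * M)
      (fun J hJ hI => by
        rw [hE]
        exact card_le_of_independent_of_edist_le hr hM v hI fun u hu =>
          (mem_candidatesWithin.1 (hJ hu)).2)
      (card_candidatesWithin_le (by push_cast; linarith) x s v)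
    rw [show 3 * (E - 1) + 6 = 3 * E + 3 by omega, Nat.sub_add_cancel hE1] at h
    refine h.trans ?_
    rw [mul_assoc, ← mul_pow]
    gcongr
    nlinarith
  calc decisionSteps (extendedGraph M (conflictGraph x)) w r D v
      ≤ ∑ _τ ∈ range D, (3 * E + 3) * (2 * M) ^ E * (nearCount x (4 * r + 2) v.1 + 1) ^ E :=
        sum_le_sum fun τ _ => hstep _
    _ = _ := by rw [sum_const, card_range, smul_eq_mul]

theorem lintegral_decisionSteps_le {M r : ℕ} (hM : 1 ≤ M) (hr : 1 ≤ r) (ha : 0 < a) (hb : 0 < b)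
    (hN : 1 ≤ N) (w : Fin N × Fin M → ℝ) (D : ℕ) (v : Fin N × Fin M) {E : ℕ}
    (hE : E = M * (2 * r + 1) ^ 2) :
    ∫⁻ x, (decisionSteps (extendedGraph M (conflictGraph x)) w r D v : ENNReal)
        ∂locationLaw N a b ≤
      ENNReal.ofReal ((3 * E + 3) * (2 * M) ^ E * (E.factorial * Real.exp 3) *
        ((8 * r + 4) ^ 2) ^ E * D * (max 1 (averageDegree N a b)) ^ E) := by
  set d := averageDegree N a b
  have hmean : ((N : ℝ) - 1) * squareShare a b (2 * (4 * r + 2)) ≤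
      (8 * r + 4) ^ 2 * max 1 d := by
    have hN1 : (0 : ℝ) ≤ (N : ℝ) - 1 := by
      have : (1 : ℝ) ≤ N := by exact_mod_cast hN
      linarith
    rw [show (2 : ℝ) * (4 * r + 2) = 8 * r + 4 by ring]
    calc ((N : ℝ) - 1) * squareShare a b (8 * r + 4)
        ≤ ((N : ℝ) - 1) * ((8 * r + 4) ^ 2 * squareShare a b 1) := by
          gcongr
          refine squareShare_le_sq_mul ha hb ?_
          have : (0 : ℝ) ≤ r := Nat.cast_nonneg r
          linarith
      _ = (8 * r + 4) ^ 2 * (((N : ℝ) - 1) * squareShare a b 1) := by ring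
      _ ≤ (8 * r + 4) ^ 2 * max 1 d := by
          gcongr
          exact (le_averageDegree ha hb hN).trans (le_max_right _ _)
  have hm : (1 : ℝ) ≤ (8 * r + 4) ^ 2 * max 1 d := by
    have h₁ : (1 : ℝ) ≤ (8 * r + 4) ^ 2 := by
      have : (0 : ℝ) ≤ r := Nat.cast_nonneg r
      nlinarith
    exact one_le_mul_of_one_le_of_one_le h₁ (le_max_left 1 d)
  calc ∫⁻ x, (decisionSteps (extendedGraph M (conflictGraph x)) w r D v : ENNReal)
        ∂locationLaw N a b
      ≤ ∫⁻ x, ENNReal.ofReal (D * ((3 * E + 3) * (2 * M) ^ E)) *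
          ENNReal.ofReal ((nearCount x (4 * r + 2) v.1 + 1 : ℝ) ^ E) ∂locationLaw N a b := by
        refine lintegral_mono fun x => ?_
        rw [← ENNReal.ofReal_mul (by positivity), ← ENNReal.ofReal_natCast]
        refine ENNReal.ofReal_le_ofReal ?_
        have h : (decisionSteps (extendedGraph M (conflictGraph x)) w r D v : ℝ) ≤ _ :=
          Nat.cast_le.2 (decisionSteps_le hM hr x w D v hE)
        refine h.trans (le_of_eq ?_)
        push_cast
        ring
    _ = ENNReal.ofReal (D * ((3 * E + 3) * (2 * M) ^ E)) *
          ∫⁻ x, ENNReal.ofReal ((nearCount x (4 * r + 2) v.1 + 1 : ℝ) ^ E)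
            ∂locationLaw N a b := lintegral_const_mul' _ _ ENNReal.ofReal_ne_top
    _ ≤ ENNReal.ofReal (D * ((3 * E + 3) * (2 * M) ^ E)) *
          ENNReal.ofReal (E.factorial * Real.exp 3 * ((8 * r + 4) ^ 2 * max 1 d) ^ E) := by
        gcongr
        exact lintegral_nearCount_pow_le ha hb hN (by positivity) hm hmean v.1 E
    _ = _ := by
        rw [← ENNReal.ofReal_mul (by positivity), mul_pow _ (max 1 d)]
        congr 1
        ring

/-! ### The heaviest nodes -/

theorem exists_top_finset {ι β : Type*} [Fintype ι] [LinearOrder β] (f : ι → β) (m : ℕ) :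
    ∃ S : Finset ι, S.card ≤ m ∧ (S.card = m ∨ S = univ) ∧ ∀ i ∈ S, ∀ k ∉ S, f k ≤ f i := by
  classical
  induction m with
  | zero => exact ⟨∅, by simp⟩
  | succ m ih =>
    obtain ⟨S, h₁, h₂, h₃⟩ := ih
    rcases h₂ with h₂ | rfl
    · rcases (Sᶜ).eq_empty_or_nonempty with h | h
      · rw [compl_eq_empty_iff] at h
        exact ⟨S, by omega, Or.inr h, h₃⟩
      · obtain ⟨i, hi, hmax⟩ := exists_max_image Sᶜ f h
        have hiS : i ∉ S := mem_compl.1 hi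
        refine ⟨insert i S, ?_, Or.inl ?_, ?_⟩
        · rw [card_insert_of_notMem hiS]; omega
        · rw [card_insert_of_notMem hiS, h₂]
        · intro j hj k hk
          rw [mem_insert, not_or] at hk
          rcases mem_insert.1 hj with rfl | hj
          · exact hmax k (mem_compl.2 hk.2)
          · exact h₃ j hj k hk.2
    · exact ⟨univ, by omega, Or.inr rfl, by simp⟩

/-- The weight of `K` elements against that of the `m` heaviest ones: an element outside the
latter has at most their mean weight. -/
theorem sum_le_mul_sum_of_top {ι : Type*} [Fintype ι] {f : ι → ℝ} (hf : ∀ i, 0 ≤ f i) {m : ℕ}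
    (hm : 0 < m) {S : Finset ι} (hS : S.card = m ∨ S = univ)
    (htop : ∀ i ∈ S, ∀ k ∉ S, f k ≤ f i) {J : Finset ι} {K : ℝ} (hJ : (J.card : ℝ) ≤ K) :
    ∑ i ∈ J, f i ≤ (1 + K / m) * ∑ i ∈ S, f i := by
  classical
  set T := ∑ i ∈ S, f i
  have hT : 0 ≤ T := sum_nonneg fun i _ => hf i
  have hm' : (0 : ℝ) < m := by exact_mod_cast hm
  have hout : ∀ k ∈ J \ S, f k ≤ T / m := by
    intro k hk
    have hkS := (mem_sdiff.1 hk).2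
    have hcard : S.card = m := hS.resolve_right fun h => hkS (h ▸ mem_univ k)
    rw [le_div_iff₀ hm', mul_comm, ← nsmul_eq_mul, ← hcard]
    exact card_nsmul_le_sum S f (f k) fun i hi => htop i hi k hkS
  have hsdiff : ((J \ S).card : ℝ) ≤ K :=
    (Nat.cast_le.2 (card_le_card sdiff_subset)).trans hJ
  calc ∑ i ∈ J, f i = ∑ i ∈ J ∩ S, f i + ∑ i ∈ J \ S, f i := (sum_inter_add_sum_sdiff _ _ _).symm
    _ ≤ T + (J \ S).card • (T / m) := by
        gcongr
        · exact sum_le_sum_of_subset_of_nonneg inter_subset_right fun i _ _ => hf i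
        · exact sum_le_card_nsmul _ _ _ hout
    _ ≤ T + K * (T / m) := by rw [nsmul_eq_mul]; gcongr
    _ = (1 + K / m) * T := by ring

/-- If every summand is lost with probability at most `1/2`, then a quarter of the sum remains
with probability at least `1/3`, by Markov's inequality for the lost part. -/
theorem one_third_le_measure_quarter_le_sum {Ω ι : Type*} [MeasurableSpace Ω] (μ : Measure Ω)
    [IsProbabilityMeasure μ] (S : Finset ι) {f : ι → ℝ} (hf : ∀ i, 0 ≤ f i) {B : ι → Set Ω}
    (hB : ∀ i, MeasurableSet (B i)) (hμB : ∀ i ∈ S, μ.real (B i) ≤ 1 / 2) :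
    1 / 3 ≤ μ.real {ω | (∑ i ∈ S, f i) / 4 ≤ ∑ i ∈ S, (B i)ᶜ.indicator (fun _ => f i) ω} := by
  set T := ∑ i ∈ S, f i
  have hT : 0 ≤ T := sum_nonneg fun i _ => hf i
  rcases hT.eq_or_lt with h0 | hpos
  · have : {ω | T / 4 ≤ ∑ i ∈ S, (B i)ᶜ.indicator (fun _ => f i) ω} = Set.univ := by
      refine Set.eq_univ_of_forall fun ω => ?_
      change T / 4 ≤ _
      rw [← h0, zero_div]
      exact sum_nonneg fun i _ => Set.indicator_nonneg (fun _ _ => hf i) _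
    rw [this, probReal_univ]
    norm_num
  let Z : Ω → ℝ := fun ω => ∑ i ∈ S, (B i).indicator (fun _ => f i) ω
  have hZint : ∀ i, Integrable ((B i).indicator fun _ => f i) μ :=
    fun i => (integrable_const _).indicator (hB i)
  have hEZ : ∫ ω, Z ω ∂μ ≤ T / 2 := by
    simp only [Z]
    rw [integral_finsetSum _ fun i _ => hZint i, sum_div]
    refine sum_le_sum fun i hi => ?_
    rw [integral_indicator_const _ (hB i), smul_eq_mul]
    nlinarith [hμB i hi, hf i]
  have hmarkov := mul_meas_ge_le_integral_of_nonneg (μ := μ) (f := Z)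
    (Filter.Eventually.of_forall fun ω =>
      sum_nonneg fun i _ => Set.indicator_nonneg (fun _ _ => hf i) _)
    (integrable_finsetSum _ fun i _ => hZint i) (3 * T / 4)
  have hle : μ.real {ω | 3 * T / 4 ≤ Z ω} ≤ 2 / 3 := by
    by_contra! h
    nlinarith
  have hZm : MeasurableSet {ω | 3 * T / 4 ≤ Z ω} :=
    measurableSet_le measurable_const
      (Finset.measurable_sum _ fun i _ => measurable_const.indicator (hB i))
  have hcompl := probReal_compl_eq_one_sub (μ := μ) hZm
  have hsub : {ω | 3 * T / 4 ≤ Z ω}ᶜ ⊆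
      {ω | T / 4 ≤ ∑ i ∈ S, (B i)ᶜ.indicator (fun _ => f i) ω} := by
    intro ω hω
    have hω' : Z ω < 3 * T / 4 := not_le.1 hω
    have hsum : Z ω + ∑ i ∈ S, (B i)ᶜ.indicator (fun _ => f i) ω = T := by
      rw [← sum_add_distrib]
      refine sum_congr rfl fun i _ => ?_
      exact Set.indicator_self_add_compl_apply (B i) (fun _ => f i) ω
    change T / 4 ≤ _
    linarith
  have := measureReal_mono (μ := μ) hsub
  linarith

/-! ### The approximation ratio -/

theorem exists_heaviest_channel {M : ℕ} (hM : 1 ≤ M) (w : Fin N × Fin M → ℝ) (i : Fin N) :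
    ∃ c, ∀ j, NotHeavier w (i, j) (i, c) := by
  have : Nonempty (Fin M) := ⟨⟨0, hM⟩⟩
  obtain ⟨c, hc⟩ := Finite.exists_max fun j : Fin M =>
    toLex (w (i, j), finProdFinEquiv (i, j))
  exact ⟨c, fun j => notHeavier_iff_toLex_le.2 (hc j)⟩

/-- An independent set weighs no more than its nodes, counted with their heaviest channels. -/
theorem weight_le_sum_image_fst {M : ℕ} {G : SimpleGraph (Fin N)} {w : Fin N × Fin M → ℝ}
    {t : Fin N → Fin M} (ht : ∀ i j, NotHeavier w (i, j) (i, t i))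
    {J : Finset (Fin N × Fin M)} (hJ : Independent (extendedGraph M G) J) :
    weight w J ≤ ∑ i ∈ J.image Prod.fst, w (i, t i) := by
  have hinj : Set.InjOn Prod.fst (J : Set (Fin N × Fin M)) := by
    intro u hu v hv h
    by_contra hne
    exact hJ hu hv hne (Or.inl ⟨h, fun h' => hne (Prod.ext h h')⟩)
  rw [sum_image hinj]
  exact sum_le_sum fun u _ => (ht u.1 u.2).le

/-- The event that another node of `S` is within distance `R` of node `i`. -/
def crowded (S : Finset (Fin N)) (R : ℝ) (i : Fin N) : Set (Fin N → Point) :=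
  ⋃ k ∈ S.erase i, {x | dist (x i) (x k) ≤ R}

theorem measurableSet_crowded (S : Finset (Fin N)) (R : ℝ) (i : Fin N) :
    MeasurableSet (crowded S R i) :=
  Finset.measurableSet_biUnion _ fun k _ => measurableSet_dist_le i k R

theorem locationLaw_crowded_le (ha : 0 < a) (hb : 0 < b) {R : ℝ} (hR : 0 < R)
    {S : Finset (Fin N)} {i : Fin N} (hi : i ∈ S) :
    (locationLaw N a b).real (crowded S R i) ≤
      ((S.card : ℝ) - 1) * squareShare a b (2 * R) := by
  have := isProbabilityMeasure_locationLaw (N := N) ha hb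
  have hq : 0 < squareShare a b (2 * R) := squareShare_pos ha hb (by linarith)
  refine (measureReal_biUnion_finset_le _ _).trans ?_
  calc ∑ k ∈ S.erase i, (locationLaw N a b).real {x | dist (x i) (x k) ≤ R}
      ≤ ∑ _k ∈ S.erase i, squareShare a b (2 * R) := by
        refine sum_le_sum fun k hk => ENNReal.toReal_le_of_le_ofReal hq.le ?_
        exact locationLaw_dist_le_le ha hb hR (ne_of_mem_erase hk).symm
    _ = ((S.card : ℝ) - 1) * squareShare a b (2 * R) := by
        rw [sum_const, card_erase_of_mem hi, nsmul_eq_mul,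
          Nat.cast_sub (card_pos.2 ⟨i, hi⟩), Nat.cast_one]

/-- A node of the top set `S` without other nodes of `S` nearby is a leader of the first
mini-round on its heaviest channel. -/
theorem isLocalLeader_of_notMem_crowded {M r : ℕ} {w : Fin N × Fin M → ℝ} {t : Fin N → Fin M}
    (ht : ∀ i j, NotHeavier w (i, j) (i, t i)) {S : Finset (Fin N)}
    (htop : ∀ i ∈ S, ∀ k ∉ S, NotHeavier w (k, t k) (i, t i)) {x : Fin N → Point} {i : Fin N}
    (hi : i ∈ S) (hx : x ∉ crowded S (4 * r + 2) i) :
    IsLocalLeader (extendedGraph M (conflictGraph x)) w r ⟨univ, ∅⟩ (i, t i) := by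
  refine ⟨mem_univ _, fun u hu => ?_⟩
  have hd := dist_le_of_edist_le (mem_candidatesWithin.1 hu).2
  by_cases hui : u.1 = i
  · subst hui
    exact ht u.1 u.2
  · have huS : u.1 ∉ S := by
      intro huS
      refine hx (Set.mem_biUnion (mem_coe.2 (mem_erase.2 ⟨hui, huS⟩)) ?_)
      change dist (x i) (x u.1) ≤ 4 * r + 2
      push_cast at hd
      linarith
    exact (ht u.1 u.2).trans (htop i hi u.1 huS)

/-- In terms of `R = 4 * r + 2`, the ratio is `4 * (1 + 2 * (M * (2 * R + 1) ^ 2))`: independent sets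
weigh at most `1 + 2 * (M * (2 * R + 1) ^ 2)` times the total weight of the top nodes, of which the
winners retain a quarter. -/
theorem one_third_le_isApproxMWIS {M r : ℕ} (hM : 1 ≤ M) (ha : 0 < a) (hb : 0 < b)
    {w : Fin N × Fin M → ℝ} (hw : ∀ v, 0 ≤ w v) {D : ℕ} (hD : 1 ≤ D) :
    ENNReal.ofReal (1 / 3) ≤ locationLaw N a b
      {x | IsApproxMWIS (extendedGraph M (conflictGraph x)) w
        (4 * (1 + 2 * (M * (8 * r + 5) ^ 2)))
        (decision (extendedGraph M (conflictGraph x)) w r D)} := by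
  classical
  have hprob := isProbabilityMeasure_locationLaw (N := N) ha hb
  choose t ht using exists_heaviest_channel hM w
  have hR : (0 : ℝ) < 4 * r + 2 := by positivity
  set q := squareShare a b (2 * (4 * r + 2)) with hq_def
  have hq : 0 < q := squareShare_pos ha hb (by linarith)
  -- The largest number of top nodes for which the union bound `(m - 1) * q` is at most `1 / 2`.
  set m := ⌊1 / (2 * q)⌋₊ + 1 with hm_def
  have hm₁ : ((m : ℝ) - 1) * q ≤ 1 / 2 := by
    have := Nat.floor_le (by positivity : (0 : ℝ) ≤ 1 / (2 * q))
    rw [le_div_iff₀ (by positivity)] at this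
    rw [hm_def]
    push_cast
    linarith
  have hm₂ : 1 ≤ 2 * q * m := by
    have := (Nat.lt_floor_add_one (1 / (2 * q))).le
    rw [div_le_iff₀ (by positivity)] at this
    rw [hm_def]
    push_cast
    linarith
  obtain ⟨S, hS₁, hS₂, hS₃⟩ := exists_top_finset
    (fun i : Fin N => toLex (w (i, t i), finProdFinEquiv (i, t i))) m
  have htop : ∀ i ∈ S, ∀ k ∉ S, NotHeavier w (k, t k) (i, t i) :=
    fun i hi k hk => notHeavier_iff_toLex_le.2 (hS₃ i hi k hk)
  have hcrowded : ∀ i ∈ S, (locationLaw N a b).real (crowded S (4 * r + 2) i) ≤ 1 / 2 := by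
    intro i hi
    refine (locationLaw_crowded_le ha hb hR hi).trans (le_trans ?_ hm₁)
    have : (S.card : ℝ) ≤ m := by exact_mod_cast hS₁
    gcongr
  have hmain := one_third_le_measure_quarter_le_sum (locationLaw N a b) S
    (f := fun i => w (i, t i)) (fun i => hw _) (measurableSet_crowded S (4 * r + 2)) hcrowded
  refine (ENNReal.ofReal_le_ofReal hmain).trans ?_
  rw [ofReal_measureReal]
  refine measure_mono_ae ?_
  filter_upwards [ae_forall_mem_rectangle (N := N) ha hb] with x hx hgood
  refine ⟨independent_decision D, fun J hJ => ?_⟩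
  set T := ∑ i ∈ S, w (i, t i)
  have hT : 0 ≤ T := sum_nonneg fun i _ => hw _
  have hdec : T / 4 ≤ weight w (decision (extendedGraph M (conflictGraph x)) w r D) := by
    refine le_trans hgood ?_
    have hL := weight_le_weight_decision (H := extendedGraph M (conflictGraph x)) (r := r) hw hD
      ((S.filter fun i => x ∉ crowded S (4 * r + 2) i).image fun i => (i, t i)) (by
        intro v hv
        obtain ⟨i, hi, rfl⟩ := mem_image.1 hv
        rw [mem_filter] at hi
        exact isLocalLeader_of_notMem_crowded ht htop hi.1 hi.2)
    rw [weight, sum_image fun i _ j _ h => (Prod.ext_iff.1 h).1, sum_filter] at hL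
    refine le_trans (le_of_eq ?_) hL
    refine sum_congr rfl fun i _ => ?_
    simp [Set.indicator_apply]
  set K : ℝ := M * ((⌊a⌋₊ + 1) * (⌊b⌋₊ + 1)) with hK_def
  have hJcard : (((J.image Prod.fst).card : ℕ) : ℝ) ≤ K := by
    have := (card_image_le (s := J) (f := Prod.fst)).trans (card_le_of_independent hx hJ)
    rw [hK_def]
    exact_mod_cast this
  have hKm : K / m ≤ 2 * (M * (8 * r + 5) ^ 2) := by
    have hKq : K * q ≤ M * (8 * r + 5) ^ 2 := by
      have := mul_squareShare_le ha hb (by linarith : (0 : ℝ) < 2 * (4 * r + 2))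
      rw [hK_def, mul_assoc]
      gcongr
      refine this.trans (le_of_eq ?_)
      ring
    have hK0 : 0 ≤ K := by positivity
    rw [div_le_iff₀ (by positivity)]
    calc K ≤ K * (2 * q * m) := le_mul_of_one_le_right hK0 hm₂
      _ = 2 * (K * q) * m := by ring
      _ ≤ 2 * (M * (8 * r + 5) ^ 2) * m := by gcongr
  calc weight w J ≤ ∑ i ∈ J.image Prod.fst, w (i, t i) := weight_le_sum_image_fst ht hJ
    _ ≤ (1 + K / m) * T := sum_le_mul_sum_of_top (f := fun i => w (i, t i)) (fun i => hw _)
        (Nat.succ_pos _) hS₂ (fun i hi k hk => (htop i hi k hk).le) hJcard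
    _ ≤ (1 + 2 * (M * (8 * r + 5) ^ 2)) * T := by gcongr
    _ = 4 * (1 + 2 * (M * (8 * r + 5) ^ 2)) * (T / 4) := by ring
    _ ≤ _ := by gcongr

end ChannelAccess

theorem mainTheorem4 (M r : ℕ) (hM : 1 ≤ M) (hr : 1 ≤ r) (ρ : ℝ) (hρ : 1 < ρ)
    (hρr : (M : ℝ) * (2 * (r : ℝ) + 1) ^ 2 ≤ ρ ^ r) :
    ∃ α p C : ℝ, 1 ≤ α ∧ 0 < p ∧ 0 < C ∧
      ∀ (d : ℝ), 0 ≤ d → ∀ (D : ℕ), 1 ≤ D → ∀ (N : ℕ), 1 ≤ N →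
        ∀ (a b : ℝ), 0 < a → 0 < b → ChannelAccess.averageDegree N a b = d →
          ∀ w : Fin N × Fin M → ℝ, (∀ v, 0 ≤ w v) →
            ENNReal.ofReal p ≤ ChannelAccess.locationLaw N a b
              {x | ChannelAccess.IsApproxMWIS
                (ChannelAccess.extendedGraph M (ChannelAccess.conflictGraph x)) w α
                (ChannelAccess.decision
                  (ChannelAccess.extendedGraph M (ChannelAccess.conflictGraph x)) w r D)} ∧
            ∀ v : Fin N × Fin M,
              ∫⁻ x, (ChannelAccess.decisionSteps
                  (ChannelAccess.extendedGraph M (ChannelAccess.conflictGraph x)) w r D v :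
                    ENNReal) ∂(ChannelAccess.locationLaw N a b)
                ≤ ENNReal.ofReal (C * (D : ℝ) * (max 1 d) ^ (ρ ^ r)) := by
  obtain ⟨E, hE⟩ : ∃ E, E = M * (2 * r + 1) ^ 2 := ⟨_, rfl⟩
  have hM0 : (0 : ℝ) < M := by exact_mod_cast hM
  refine ⟨4 * (1 + 2 * (M * (8 * r + 5) ^ 2)), 1 / 3,
    (3 * E + 3) * (2 * M) ^ E * (E.factorial * Real.exp 3) * ((8 * r + 4) ^ 2) ^ E,
    ?_, by norm_num, by positivity, ?_⟩
  · have : (0 : ℝ) ≤ M * (8 * r + 5) ^ 2 := by positivity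
    linarith
  rintro d - D hD N hN a b ha hb rfl w hw
  refine ⟨ChannelAccess.one_third_le_isApproxMWIS hM ha hb hw hD, fun v => ?_⟩
  refine (ChannelAccess.lintegral_decisionSteps_le hM hr ha hb hN w D v hE).trans ?_
  gcongr
  rw [← Real.rpow_natCast]
  refine Real.rpow_le_rpow_of_exponent_le (le_max_left _ _) ?_
  rw [hE]
  push_cast
  exact hρr
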